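/- Let $\|\cdot\|$ denote the supremum norm on $\mathbb{R}^d$ for any $d$. A real $m\times n$ matrix $A$ is called a Liouville matrix if $A\mathbf{q}-\mathbf{p}\neq \mathbf{0}$ for all $(\mathbf{p},\mathbf{q})\in(\mathbb{Z}^m\times\mathbb{Z}^n)\setminus\{\mathbf{0}\}$ and if, for every $N\in\mathbb{N}$, the inequality $\|A\mathbf{q}-\mathbf{p}\|<\|\mathbf{q}\|^{-N}$ has infinitely many solutions $\mathbf{p}\in\mathbb{Z}^m$, $\mathbf{q}\in\mathbb{Z}^n\setminus\{\mathbf{0}\}$. Let $\mathscr{L}_{n,n}$ be the set of $n\times n$ Liouville matrices. For a real function $f$ that is analytic near $0$, with power series expansion $f(z)=\sum_{j\ge 0}c_jz^j$ at $0$, put $\mathfrak{f}(A)=\sum_{j\ge 0}c_jA^j$ for every real $n\times n$ matrix $A$ for which this series converges absolutely; $\mathfrak{f}(A)$ is said to be defined for these $A$. Theorem. Let $n\ge 2$ be an integer, let $I\subseteq\mathbb{R}$ be an open interval containing $0$, and let $(f_k)_{k\ge 1}$ be a sequence of non-constant real analytic functions $f_k:I\to\mathbb{R}$. Assume that there is an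 $r>0$ such that for every $k$ the power series of $f_k$ at $0$ converges on $(-r,r)$. Then there is a set $\Omega\subseteq\mathscr{L}_{n,n}\subseteq\mathbb{R}^{n\times n}\cong\mathbb{R}^{n^2}$ of Hausdorff dimension exactly $(n-1)^2$ such that for every $A\in\Omega$ and every $k\ge 1$ the matrix $\mathfrak{f}_k(A)$ is defined and $\mathfrak{f}_k(A)\in\mathscr{L}_{n,n}$. Consequently the set $$\bigcap_{k\ge 1}\mathfrak{f}_k^{-1}(\mathscr{L}_{n,n})\cap\mathscr{L}_{n,n}$$ (of those $A\in\mathscr{L}_{n,n}$ for which every $\mathfrak{f}_k(A)$ is defined and a Liouville matrix) has Hausdorff dimension at least $(n-1)^2$; in particular it is not empty. -/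

import Mathlib

open scoped ENNReal

noncomputable section

/-- The error vector `A q - p` of the integer vectors `q`, `p` with respect to the real matrix `A`. -/
def approxError {m n : ℕ} (A : Matrix (Fin m) (Fin n) ℝ) (p : Fin m → ℤ) (q : Fin n → ℤ) :
    Fin m → ℝ :=
  A.mulVec (fun j => (q j : ℝ)) - fun i => (p i : ℝ)

/-- A real `m × n` matrix is a Liouville matrix if `A q - p ≠ 0` for all integer vectors
`(p, q) ≠ 0`, and its irrationality exponent is infinite: for every `N` the inequality
`‖A q - p‖ < ‖q‖ ^ (-N)` has infinitely many integer solutions `(p, q)` with `q ≠ 0`.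
The norms are supremum norms. -/
def IsLiouvilleMatrix {m n : ℕ} (A : Matrix (Fin m) (Fin n) ℝ) : Prop :=
  (∀ (p : Fin m → ℤ) (q : Fin n → ℤ), (p, q) ≠ 0 → approxError A p q ≠ 0) ∧
  ∀ N : ℕ, {pq : (Fin m → ℤ) × (Fin n → ℤ) |
    pq.2 ≠ 0 ∧ ‖approxError A pq.1 pq.2‖ < ‖pq.2‖ ^ (-(N : ℤ))}.Infinite

/-- The set of real `m × n` Liouville matrices. -/
def liouvilleMatrices (m n : ℕ) : Set (Matrix (Fin m) (Fin n) ℝ) :=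
  {A | IsLiouvilleMatrix A}

/-- The coefficient `c_j` of the power series expansion of `f` at `0`. -/
def taylorCoeffZero (f : ℝ → ℝ) (j : ℕ) : ℝ :=
  iteratedDeriv j f 0 / (j.factorial : ℝ)

/-- The square matrices at which the power series `∑ c_j A ^ j` of `f` at `0` converges
(absolutely, since the space of matrices is finite-dimensional). -/
def matrixExtDomain (n : ℕ) (f : ℝ → ℝ) : Set (Matrix (Fin n) (Fin n) ℝ) :=
  {A | Summable fun j : ℕ => taylorCoeffZero f j • A ^ j}

/-- The extension `A ↦ ∑ c_j A ^ j` of `f` to matrices; meaningful on `matrixExtDomain n f`. -/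
def matrixExt (n : ℕ) (f : ℝ → ℝ) (A : Matrix (Fin n) (Fin n) ℝ) : Matrix (Fin n) (Fin n) ℝ :=
  ∑' j : ℕ, taylorCoeffZero f j • A ^ j

section HausdorffDimension

attribute [local instance] Matrix.normedAddCommGroup

/-- The Hausdorff dimension of a set of real `m × n` matrices, with respect to the supremum norm
of the entries (any other norm gives the same value). -/
def matrixDimH {m n : ℕ} (S : Set (Matrix (Fin m) (Fin n) ℝ)) : ℝ≥0∞ :=
  dimH S

end HausdorffDimension

end

/-! Put `m = n - 1` and look at block diagonal matrices with blocks `x` and `B`. A power series `f`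
acts blockwise, giving the blocks `f x` and `f B`. If `f x` is a Liouville number, good rational
approximations `a / b` to it yield solutions `q = (b, 0, ..., 0)`, so only one condition is left for
`B`: `f B` must send no nonzero integer vector to an integer vector.

The number `x` comes from Baire category (`exists_forall_liouville_tsum`): Liouville numbers form a
dense Gδ, and so do their preimages under each nonconstant series on `(-r, r)`. With `x` fixed,
almost every small invertible `B` works (`volume_setOf_mulVec_tsum_eq`): on a ray `t ↦ t B`, some
coordinate of `f (t B) q` is a nonconstant power series in `t`, which takes a given value only
countably often, and Fubini makes the bad set null. The good `B` thus have positive measure in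
dimension `m ^ 2`, and the isometric embedding `B ↦ blockCons x B` gives dimension exactly `m ^ 2`.
-/

/-! ### Real power series and their level sets -/

/-- The sum of a real power series that converges on `(-s, s)` is analytic there. -/
theorem analyticOnNhd_tsum_mul_pow {a : ℕ → ℝ} {s : ℝ}
    (ha : ∀ x : ℝ, |x| < s → Summable fun j => a j * x ^ j) :
    AnalyticOnNhd ℝ (fun x => ∑' j, a j * x ^ j) (Metric.ball 0 s) := by
  rcases le_or_gt s 0 with hs | hs
  · simp [Metric.ball_eq_empty.2 hs, AnalyticOnNhd]
  set P := FormalMultilinearSeries.ofScalars ℝ a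
  have hP : ENNReal.ofReal s ≤ P.radius := by
    refine ENNReal.le_of_forall_nnreal_lt fun t ht => ?_
    refine P.le_radius_of_summable ?_
    have hts : (t : ℝ) < s := by
      rwa [← ENNReal.ofReal_coe_nnreal, ENNReal.ofReal_lt_ofReal_iff hs] at ht
    have := (ha t (by rwa [abs_of_nonneg t.coe_nonneg])).norm
    simpa [P, FormalMultilinearSeries.ofScalars_norm, abs_mul] using this
  have h := (P.hasFPowerSeriesOnBall ((ENNReal.ofReal_pos.2 hs).trans_le hP)).analyticOnNhd
  have h' : P.sum = fun x => ∑' j, a j * x ^ j := by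
    have := FormalMultilinearSeries.ofScalarsSum_eq_tsum (E := ℝ) a
    simpa [FormalMultilinearSeries.ofScalarsSum, P] using this
  rw [h'] at h
  refine h.mono ?_
  rw [← Metric.eball_ofReal]
  exact Metric.eball_subset_eball hP

/-- A power series that is constant near `0` has no nonconstant terms. -/
theorem coeff_eq_zero_of_eventually_tsum_eq {a : ℕ → ℝ} {s : ℝ} (hs : 0 < s)
    (ha : ∀ x : ℝ, |x| < s → Summable fun j => a j * x ^ j) {v : ℝ}
    (hv : ∀ᶠ x in nhds 0, ∑' j, a j * x ^ j = v) {j : ℕ} (hj : 1 ≤ j) : a j = 0 := by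
  set P := FormalMultilinearSeries.ofScalars ℝ a
  have hP : 0 < P.radius := by
    have ht : (0 : ℝ) < s / 2 := by positivity
    refine lt_of_lt_of_le (b := ((s / 2).toNNReal : ℝ≥0∞)) (by simpa using ht) ?_
    refine P.le_radius_of_summable ?_
    have := (ha (s / 2) (by rw [abs_of_pos ht]; linarith)).norm
    simpa [P, FormalMultilinearSeries.ofScalars_norm, abs_mul, ht.le, abs_of_pos hs] using this
  have h := (P.hasFPowerSeriesOnBall hP).hasFPowerSeriesAt
  have h' : P.sum = fun x => ∑' j, a j * x ^ j := by
    have := FormalMultilinearSeries.ofScalarsSum_eq_tsum (E := ℝ) a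
    simpa [FormalMultilinearSeries.ofScalarsSum, P] using this
  rw [h'] at h
  have hc : HasFPowerSeriesAt (fun _ : ℝ => v) (constFormalMultilinearSeries ℝ ℝ v) 0 :=
    hasFPowerSeriesAt_const
  have heq := (h.congr hv).eq_formalMultilinearSeries hc
  have hcoeff : P.coeff j = 0 := by
    rw [heq, FormalMultilinearSeries.coeff,
      constFormalMultilinearSeries_apply_of_nonzero (show j ≠ 0 by omega)]
    rfl
  rwa [FormalMultilinearSeries.coeff_ofScalars] at hcoeff

/-- The level sets of a nonconstant real power series are countable. -/
theorem countable_setOf_tsum_eq {a : ℕ → ℝ} {s : ℝ}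
    (ha : ∀ x : ℝ, |x| < s → Summable fun j => a j * x ^ j)
    (hne : ∃ j, 1 ≤ j ∧ a j ≠ 0) (v : ℝ) :
    {x : ℝ | |x| < s ∧ ∑' j, a j * x ^ j = v}.Countable := by
  rcases le_or_gt s 0 with hs | hs
  · convert Set.countable_empty
    ext x
    simp only [Set.mem_ofPred_eq, Set.mem_empty_iff_false, iff_false, not_and]
    intro h
    linarith [abs_nonneg x]
  obtain ⟨j, hj, haj⟩ := hne
  have hA := analyticOnNhd_tsum_mul_pow ha
  rcases hA.eqOn_or_eventually_ne_of_preconnected (analyticOnNhd_const (v := v))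
    (Metric.isConnected_ball hs).isPreconnected with h | h
  · refine absurd (coeff_eq_zero_of_eventually_tsum_eq hs ha (v := v) ?_ hj) haj
    filter_upwards [Metric.ball_mem_nhds (0 : ℝ) hs] with x hx using h hx
  · set Z := {x : ℝ | ∑' j, a j * x ^ j = v}
    have hZ : Zᶜ ∈ Filter.codiscreteWithin (Metric.ball (0 : ℝ) s) := h
    have : DiscreteTopology ↑(Z ∩ Metric.ball 0 s) :=
      isDiscrete_iff_discreteTopology.mp (isDiscrete_of_codiscreteWithin hZ)
    -- A subspace of `ℝ` is separable, and a separable discrete space is countable.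
    have hcount : (Z ∩ Metric.ball 0 s).Countable :=
      TopologicalSpace.separableSpace_iff_countable.1 inferInstance
    refine hcount.mono ?_
    rintro x ⟨hx, hxv⟩
    exact ⟨hxv, by simpa using hx⟩

/-! ### A common point with Liouville values -/

/-- Countably many nonconstant power series with a common interval of convergence take Liouville
values at a common point. -/
theorem exists_forall_liouville_tsum {c : ℕ → ℕ → ℝ} {r : ℝ} (hr : 0 < r)
    (hc : ∀ k (x : ℝ), |x| < r → Summable fun j => c k j * x ^ j)
    (hne : ∀ k, ∃ j, 1 ≤ j ∧ c k j ≠ 0) :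
    ∃ x : ℝ, |x| < r ∧ ∀ k, Liouville (∑' j, c k j * x ^ j) := by
  obtain ⟨O, hO, hLO⟩ := IsGδ.setOfPred_liouville.eq_iInter_nat
  have hOd : ∀ n, Dense (O n) := fun n =>
    dense_liouville.mono (hLO.trans_subset (Set.iInter_subset _ n))
  set g : ℕ → ℝ → ℝ := fun k x => ∑' j, c k j * x ^ j
  have hg : ∀ k, ContinuousOn (g k) (Metric.ball 0 r) := fun k =>
    (analyticOnNhd_tsum_mul_pow (hc k)).continuousOn
  -- Adding the exterior of the closed ball makes these sets dense in all of `ℝ`, so that Baire's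
  -- theorem applies there; only the points `±r` are lost.
  set D : ℕ × ℕ → Set ℝ := fun kn =>
    (Metric.ball 0 r ∩ g kn.1 ⁻¹' O kn.2) ∪ (Metric.closedBall 0 r)ᶜ
  have hDo : ∀ kn, IsOpen (D kn) := fun kn =>
    ((hg kn.1).isOpen_inter_preimage Metric.isOpen_ball (hO kn.2)).union
      Metric.isClosed_closedBall.isOpen_compl
  have hDd : ∀ kn, Dense (D kn) := by
    rintro ⟨k, n⟩
    rw [dense_iff_inter_open]
    intro V hV hVne
    by_cases hVc : (V ∩ (Metric.closedBall 0 r)ᶜ).Nonempty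
    · obtain ⟨x, hx, hx'⟩ := hVc
      exact ⟨x, hx, Or.inr hx'⟩
    have hVsub : V ⊆ Metric.closedBall 0 r := by
      intro x hx
      by_contra hx'
      exact hVc ⟨x, hx, hx'⟩
    have hVb : V ⊆ Metric.ball 0 r := by
      have := interior_mono hVsub
      rwa [hV.interior_eq, interior_closedBall _ hr.ne'] at this
    obtain ⟨x, hx⟩ := hVne
    obtain ⟨ε, hε, hεV⟩ := Metric.isOpen_iff.1 hV x hx
    have hconn : IsPreconnected (g k '' Metric.ball x ε) :=
      (Metric.isConnected_ball hε).isPreconnected.image _ ((hg k).mono (hεV.trans hVb))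
    -- Otherwise an interval would lie in a countable level set. A nontrivial connected image
    -- contains an interval, which meets the dense set `O n`.
    have hnt : (g k '' Metric.ball x ε).Nontrivial := by
      by_contra hnot
      rw [Set.not_nontrivial_iff] at hnot
      have hsub : Metric.ball x ε ⊆ {y : ℝ | |y| < r ∧ g k y = g k x} := by
        intro y hy
        refine ⟨by simpa using hVb (hεV hy), ?_⟩
        exact hnot ⟨y, hy, rfl⟩ ⟨x, Metric.mem_ball_self hε, rfl⟩
      have hcount := (countable_setOf_tsum_eq (hc k) (hne k) (g k x)).mono hsub
      have := hcount.measure_zero MeasureTheory.volume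
      rw [Real.volume_ball] at this
      simp at this
      linarith
    obtain ⟨u, hu, v, hv, huv⟩ := hnt.exists_lt
    obtain ⟨w, hw, hwO⟩ := (hOd n).exists_between huv
    obtain ⟨y, hy, rfl⟩ := hconn.ordConnected.out hu hv ⟨hwO.1.le, hwO.2.le⟩
    exact ⟨y, hεV hy, Or.inl ⟨hVb (hεV hy), hw⟩⟩
  have hdense := dense_iInter_of_isOpen hDo hDd
  obtain ⟨x, hx, hxD⟩ := hdense.exists_mem_open Metric.isOpen_ball
    ⟨(0 : ℝ), Metric.mem_ball_self hr⟩
  refine ⟨x, by simpa using hxD, fun k => ?_⟩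
  have : g k x ∈ ⋂ n, O n := by
    refine Set.mem_iInter.2 fun n => ?_
    rcases Set.mem_iInter.1 hx (k, n) with h | h
    · exact h.2
    · exact absurd (Metric.ball_subset_closedBall hxD) h
  rw [← hLO] at this
  exact this

/-- An analytic function on an interval around `0` with trivial Taylor series at `0` is constant. -/
theorem exists_taylorCoeffZero_ne_zero {I : Set ℝ} (hI : I.OrdConnected) (hI0 : (0 : ℝ) ∈ I)
    {f : ℝ → ℝ} (hf : AnalyticOnNhd ℝ f I) (hne : ¬ ∃ c : ℝ, ∀ x ∈ I, f x = c) :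
    ∃ j, 1 ≤ j ∧ taylorCoeffZero f j ≠ 0 := by
  by_contra! h
  refine hne ⟨f 0, ?_⟩
  have hps := (hf 0 hI0).hasFPowerSeriesAt
  have hev : f =ᶠ[nhds 0] fun _ => f 0 := by
    have := hasFPowerSeriesAt_iff.1 hps
    filter_upwards [this] with z hz
    simp only [zero_add] at hz
    have h0 : HasSum (fun n => z ^ n • (FormalMultilinearSeries.ofScalars ℝ
        (fun n => iteratedDeriv n f 0 / n.factorial)).coeff n) (f 0) := by
      convert hasSum_single (f := fun n => z ^ n • (FormalMultilinearSeries.ofScalars ℝ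
        (fun n => iteratedDeriv n f 0 / n.factorial)).coeff n) 0 ?_ using 1
      · simp
      · intro j hj
        have := h j (by omega)
        rw [taylorCoeffZero] at this
        simp [this]
    exact hz.unique h0
  exact hf.eqOn_of_preconnected_of_eventuallyEq analyticOnNhd_const hI.isPreconnected hI0 hev

/-! ### Power series of matrices -/

/-- The square matrix with the given family of entries. -/
def matrixOfPairs {m : ℕ} (b : Fin m × Fin m → ℝ) : Matrix (Fin m) (Fin m) ℝ :=
  Matrix.of fun i k => b (i, k)

theorem continuous_matrixOfPairs {m : ℕ} : Continuous (matrixOfPairs (m := m)) :=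
  continuous_matrix fun i k => continuous_apply (i, k)

theorem matrixOfPairs_smul {m : ℕ} (t : ℝ) (b : Fin m × Fin m → ℝ) :
    matrixOfPairs (t • b) = t • matrixOfPairs b := by
  ext i k
  simp [matrixOfPairs]

/-- The sum of all absolute entries dominates every row sum, so induction on the power works. Matrix
series can then be compared with the scalar series at `∑ p, |b p|`. -/
theorem abs_matrixOfPairs_pow_apply_le {m : ℕ} (b : Fin m × Fin m → ℝ) (j : ℕ) (i k : Fin m) :
    |(matrixOfPairs b ^ j) i k| ≤ (∑ p, |b p|) ^ j := by
  induction j generalizing i k with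
  | zero =>
    by_cases h : i = k <;> simp [h]
  | succ j ih =>
    have hrow : ∑ l, |b (i, l)| ≤ ∑ p, |b p| := by
      rw [Fintype.sum_prod_type]
      exact Finset.single_le_sum (f := fun i => ∑ l, |b (i, l)|)
        (fun _ _ => Finset.sum_nonneg fun _ _ => abs_nonneg _) (Finset.mem_univ i)
    have hN : 0 ≤ ∑ p, |b p| := Finset.sum_nonneg fun _ _ => abs_nonneg _
    rw [pow_succ', Matrix.mul_apply, pow_succ']
    calc |∑ l, matrixOfPairs b i l * (matrixOfPairs b ^ j) l k|
        ≤ ∑ l, |b (i, l)| * (∑ p, |b p|) ^ j := by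
          refine (Finset.abs_sum_le_sum_abs _ _).trans (Finset.sum_le_sum fun l _ => ?_)
          rw [abs_mul]
          exact mul_le_mul_of_nonneg_left (ih l k) (abs_nonneg _)
      _ = (∑ l, |b (i, l)|) * (∑ p, |b p|) ^ j := by rw [Finset.sum_mul]
      _ ≤ _ := mul_le_mul_of_nonneg_right hrow (pow_nonneg hN j)

theorem abs_matrixOfPairs_pow_mulVec_le {m : ℕ} (b : Fin m × Fin m → ℝ) (j : ℕ) (q : Fin m → ℝ)
    (i : Fin m) :
    |(matrixOfPairs b ^ j).mulVec q i| ≤ (∑ p, |b p|) ^ j * ∑ k, |q k| := by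
  rw [Matrix.mulVec, dotProduct, Finset.mul_sum]
  refine (Finset.abs_sum_le_sum_abs _ _).trans (Finset.sum_le_sum fun k _ => ?_)
  rw [abs_mul]
  exact mul_le_mul_of_nonneg_right (abs_matrixOfPairs_pow_apply_le b j i k) (abs_nonneg _)

theorem summable_smul_matrixOfPairs_pow {m : ℕ} {c : ℕ → ℝ} {r : ℝ}
    (hc : ∀ x : ℝ, |x| < r → Summable fun j => c j * x ^ j) {b : Fin m × Fin m → ℝ}
    (hb : ∑ p, |b p| < r) : Summable fun j => c j • matrixOfPairs b ^ j := by
  have hN : 0 ≤ ∑ p, |b p| := Finset.sum_nonneg fun _ _ => abs_nonneg _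
  refine Pi.summable.2 fun i => Pi.summable.2 fun k => ?_
  refine Summable.of_norm_bounded (hc _ (by rwa [abs_of_nonneg hN])).norm fun j => ?_
  simp only [Matrix.smul_apply, smul_eq_mul, norm_mul, norm_pow, Real.norm_eq_abs]
  rw [abs_of_nonneg hN]
  exact mul_le_mul_of_nonneg_left (abs_matrixOfPairs_pow_apply_le b j i k) (abs_nonneg _)

theorem mulVec_tsum_smul_pow_apply {m : ℕ} {c : ℕ → ℝ} {B : Matrix (Fin m) (Fin m) ℝ}
    (h : Summable fun j => c j • B ^ j) (q : Fin m → ℝ) (i : Fin m) :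
    HasSum (fun j => c j * (B ^ j).mulVec q i) ((∑' j, c j • B ^ j).mulVec q i) := by
  have hcont : Continuous fun M : Matrix (Fin m) (Fin m) ℝ => M.mulVec q i :=
    (continuous_apply i).comp (continuous_id.matrix_mulVec continuous_const)
  have := h.hasSum.map (AddMonoidHom.mk' (fun M : Matrix (Fin m) (Fin m) ℝ => M.mulVec q i)
    fun M M' => by simp [Matrix.add_mulVec]) hcont
  simpa [Function.comp_def, Matrix.smul_mulVec] using this

theorem isOpen_setOf_sum_abs_lt_and_det_ne_zero (m : ℕ) (ρ : ℝ) :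
    IsOpen {b : Fin m × Fin m → ℝ | ∑ p, |b p| < ρ ∧ (matrixOfPairs b).det ≠ 0} := by
  have h1 : Continuous fun b : Fin m × Fin m → ℝ => ∑ p, |b p| := by fun_prop
  have h2 : Continuous fun b : Fin m × Fin m → ℝ => (matrixOfPairs b).det :=
    continuous_matrixOfPairs.matrix_det
  exact (isOpen_lt h1 continuous_const).inter (isOpen_ne_fun h2 continuous_const)

theorem nonempty_setOf_sum_abs_lt_and_det_ne_zero (m : ℕ) {ρ : ℝ} (hρ : 0 < ρ) :
    {b : Fin m × Fin m → ℝ | ∑ p, |b p| < ρ ∧ (matrixOfPairs b).det ≠ 0}.Nonempty := by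
  set b₁ : Fin m × Fin m → ℝ := fun p => if p.1 = p.2 then 1 else 0
  set s := ∑ p, |b₁ p|
  have hs : 0 ≤ s := Finset.sum_nonneg fun _ _ => abs_nonneg _
  have h1 : matrixOfPairs b₁ = 1 := by
    ext i k
    simp [matrixOfPairs, b₁, Matrix.one_apply]
  have ht : 0 < ρ / (s + 1) := by positivity
  refine ⟨(ρ / (s + 1)) • b₁, ?_, ?_⟩
  · have : ∑ p, |((ρ / (s + 1)) • b₁) p| = ρ / (s + 1) * s := by
      simp only [Pi.smul_apply, smul_eq_mul, abs_mul, abs_of_pos ht, s, Finset.mul_sum]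
    rw [this, div_mul_eq_mul_div, div_lt_iff₀ (by positivity)]
    nlinarith
  · rw [matrixOfPairs_smul, h1, Matrix.det_smul]
    simp [ht.ne']

/-! ### The exceptional blocks form a null set -/

/-- For a nonconstant power series, a vector `q ≠ 0` and any `p`, the small invertible matrices `B`
with `(∑ c_j B ^ j) q = p` form a null set. -/
theorem volume_setOf_mulVec_tsum_eq {m : ℕ} {c : ℕ → ℝ} {r : ℝ}
    (hc : ∀ x : ℝ, |x| < r → Summable fun j => c j * x ^ j)
    (hne : ∃ j, 1 ≤ j ∧ c j ≠ 0) {q : Fin m → ℝ} (hq : q ≠ 0) (p : Fin m → ℝ) :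
    MeasureTheory.volume {b : Fin m × Fin m → ℝ |
      (∑ x, |b x| < r / 2 ∧ (matrixOfPairs b).det ≠ 0) ∧
        (∑' j, c j • matrixOfPairs b ^ j).mulVec q = p} = 0 := by
  -- The bound `r / 2` leaves room to scale: if `t₀ • b ∈ U` with `t₀ > 1`, then `t • b` stays in
  -- the region of convergence for all `|t| < 2`.
  set U : Set (Fin m × Fin m → ℝ) := {b | ∑ x, |b x| < r / 2 ∧ (matrixOfPairs b).det ≠ 0}
  have hU : IsOpen U := isOpen_setOf_sum_abs_lt_and_det_ne_zero m (r / 2)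
  set F : (Fin m × Fin m → ℝ) → Fin m → ℝ := fun b => (∑' j, c j • matrixOfPairs b ^ j).mulVec q
  set E : Set (Fin m × Fin m → ℝ) := {b | b ∈ U ∧ F b = p}
  change MeasureTheory.volume E = 0
  have hpos : ∀ b : Fin m × Fin m → ℝ, 0 ≤ ∑ x, |b x| := fun b =>
    Finset.sum_nonneg fun _ _ => abs_nonneg _
  have hFs : ∀ b : Fin m × Fin m → ℝ, ∑ x, |b x| < r → ∀ i,
      HasSum (fun j => c j * (matrixOfPairs b ^ j).mulVec q i) (F b i) := fun b hb i =>
    mulVec_tsum_smul_pow_apply (summable_smul_matrixOfPairs_pow hc hb) q i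
  have hr2 : ∀ b ∈ U, ∑ x, |b x| < r := fun b hb => by
    have h1 := hb.1
    have h2 := hpos b
    linarith
  have hF : ContinuousOn F U := by
    refine continuousOn_pi.2 fun i => ?_
    rcases le_or_gt r 0 with hr | hr
    · intro b hb
      have h1 := hr2 b hb
      have h2 := hpos b
      linarith
    have hcont : ContinuousOn
        (fun b => ∑' j, c j * (matrixOfPairs b ^ j).mulVec q i) U := by
      have hu : Summable fun j => |c j * (r / 2) ^ j| * ∑ k, |q k| :=
        (hc (r / 2) (by rw [abs_of_pos (by positivity)]; linarith)).norm.mul_right _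
      refine continuousOn_tsum (fun j => ?_) hu fun j b hb => ?_
      · exact (continuous_const.mul ((continuous_apply i).comp
          ((continuous_matrixOfPairs.pow j).matrix_mulVec continuous_const))).continuousOn
      · rw [norm_mul, Real.norm_eq_abs, Real.norm_eq_abs, abs_mul, mul_assoc]
        refine mul_le_mul_of_nonneg_left ?_ (abs_nonneg _)
        refine (abs_matrixOfPairs_pow_mulVec_le b j q i).trans ?_
        refine mul_le_mul_of_nonneg_right ?_ (Finset.sum_nonneg fun _ _ => abs_nonneg _)
        exact (pow_le_pow_left₀ (hpos b) hb.1.le j).trans (le_abs_self _)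
    exact hcont.congr fun b hb => ((hFs b (hr2 b hb) i).tsum_eq).symm
  -- `E` is relatively closed in the open set `U`; Fubini needs its measurability.
  have hE : MeasurableSet E := by
    have h1 : IsOpen (U ∩ F ⁻¹' {p}ᶜ) := hF.isOpen_inter_preimage hU isOpen_compl_singleton
    have h2 : E = U \ (U ∩ F ⁻¹' {p}ᶜ) := by
      ext b
      simp only [E, Set.mem_ofPred_eq, Set.mem_sdiff, Set.mem_inter_iff, Set.mem_preimage,
        Set.mem_compl_iff, Set.mem_singleton_iff]
      tauto
    rw [h2]
    exact hU.measurableSet.diff h1.measurableSet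
  have hray : ∀ b : Fin m × Fin m → ℝ, {t : ℝ | t ∈ Set.Ioo (1 : ℝ) 2 ∧ t • b ∈ E}.Countable := by
    intro b
    by_cases hex : ∃ t₀ : ℝ, t₀ ∈ Set.Ioo (1 : ℝ) 2 ∧ t₀ • b ∈ E
    swap
    · convert Set.countable_empty
      ext t
      simpa using fun h1 h2 h3 => hex ⟨t, ⟨h1, h2⟩, h3⟩
    have hsm : ∀ t : ℝ, ∑ x, |(t • b) x| = |t| * ∑ x, |b x| := fun t => by
      simp [abs_mul, Finset.mul_sum]
    obtain ⟨t₀, ht₀, ⟨hN, hdet⟩, -⟩ := hex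
    rw [hsm, abs_of_pos (by linarith [ht₀.1])] at hN
    have hNb : ∑ x, |b x| < r / 2 := by nlinarith [hpos b, ht₀.1]
    have hdetb : (matrixOfPairs b).det ≠ 0 := by
      rw [matrixOfPairs_smul, Matrix.det_smul] at hdet
      exact right_ne_zero_of_mul hdet
    obtain ⟨j, hj, hcj⟩ := hne
    -- Invertibility is used here: it makes the coefficient of `t ^ j` nonzero in some coordinate
    -- `i`.
    have hBq : (matrixOfPairs b ^ j).mulVec q ≠ 0 := by
      intro h0
      refine hq (Matrix.eq_zero_of_mulVec_eq_zero ?_ h0)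
      rw [Matrix.det_pow]
      exact pow_ne_zero _ hdetb
    obtain ⟨i, hi⟩ := Function.ne_iff.1 hBq
    set a : ℕ → ℝ := fun l => c l * (matrixOfPairs b ^ l).mulVec q i
    have hat : ∀ (t : ℝ) (l : ℕ),
        a l * t ^ l = c l * (matrixOfPairs (t • b) ^ l).mulVec q i := fun t l => by
      simp only [a, matrixOfPairs_smul, smul_pow, Matrix.smul_mulVec, Pi.smul_apply, smul_eq_mul]
      ring
    have hlt : ∀ t : ℝ, |t| < 2 → ∑ x, |(t • b) x| < r := fun t ht => by
      rw [hsm]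
      nlinarith [hpos b, abs_nonneg t]
    have ha : ∀ t : ℝ, |t| < 2 → Summable fun l => a l * t ^ l := fun t ht => by
      simp only [hat]
      exact (hFs _ (hlt t ht) i).summable
    refine (countable_setOf_tsum_eq ha ⟨j, hj, mul_ne_zero hcj hi⟩ (p i)).mono ?_
    rintro t ⟨ht, htE⟩
    have ht2 : |t| < 2 := by rw [abs_of_pos (by linarith [ht.1])]; exact ht.2
    refine ⟨ht2, ?_⟩
    simp only [hat]
    rw [(hFs _ (hlt t ht2) i).tsum_eq, htE.2]
  -- For each `b` almost every `t` is good, so by Fubini some `t` in `(1, 2)` is good for almost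
  -- every `b`. Since scaling by `t` preserves null sets, `E` is null.
  have hswap : ∀ᵐ t ∂(MeasureTheory.volume.restrict (Set.Ioo (1 : ℝ) 2)),
      ∀ᵐ b : Fin m × Fin m → ℝ, t • b ∉ E := by
    refine (MeasureTheory.Measure.ae_ae_comm (p := fun (b : Fin m × Fin m → ℝ) (t : ℝ) =>
      t • b ∉ E) ?_).1 ?_
    · exact (hE.preimage (measurable_snd.smul measurable_fst)).compl
    · refine Filter.Eventually.of_forall fun b => ?_
      rw [MeasureTheory.ae_restrict_iff' measurableSet_Ioo]
      have := (hray b).measure_zero MeasureTheory.volume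
      rw [MeasureTheory.ae_iff]
      convert this using 2
      ext t
      simp [and_assoc]
  have hν : (MeasureTheory.volume.restrict (Set.Ioo (1 : ℝ) 2)) ≠ 0 := by
    intro h
    have := MeasureTheory.Measure.restrict_eq_zero.1 h
    rw [Real.volume_Ioo] at this
    norm_num at this
  have : (MeasureTheory.ae (MeasureTheory.volume.restrict (Set.Ioo (1 : ℝ) 2))).NeBot :=
    MeasureTheory.ae_neBot.2 hν
  obtain ⟨t, htE, ht⟩ :=
    (hswap.and (MeasureTheory.ae_restrict_mem (measurableSet_Ioo (a := (1 : ℝ)) (b := 2)))).exists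
  have ht0 : t ≠ 0 := by linarith [ht.1]
  have hz : MeasureTheory.volume ((fun b : Fin m × Fin m → ℝ => t • b) ⁻¹' E) = 0 := by
    rw [MeasureTheory.ae_iff] at htE
    simp only [not_not] at htE
    exact htE
  rw [MeasureTheory.Measure.addHaar_preimage_smul _ ht0] at hz
  refine (mul_eq_zero.1 hz).resolve_left ?_
  have : (0 : ℝ) < |(t ^ Module.finrank ℝ (Fin m × Fin m → ℝ))⁻¹| := by positivity
  exact (ENNReal.ofReal_pos.2 this).ne'

/-! ### Block diagonal matrices -/

/-- The block diagonal matrix with blocks `x` and `B`. -/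
def blockCons {m : ℕ} (x : ℝ) (B : Matrix (Fin m) (Fin m) ℝ) :
    Matrix (Fin (m + 1)) (Fin (m + 1)) ℝ :=
  Matrix.of (Fin.cons (Fin.cons x 0) fun i => Fin.cons 0 (B i))

section blockCons

variable {m : ℕ} (x y : ℝ) (B C : Matrix (Fin m) (Fin m) ℝ)

@[simp] theorem blockCons_zero_zero : blockCons x B 0 0 = x := rfl

@[simp] theorem blockCons_zero_succ (k : Fin m) : blockCons x B 0 k.succ = 0 := rfl

@[simp] theorem blockCons_succ_zero (i : Fin m) : blockCons x B i.succ 0 = 0 := rfl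

@[simp] theorem blockCons_succ_succ (i k : Fin m) : blockCons x B i.succ k.succ = B i k := rfl

theorem blockCons_mul : blockCons x B * blockCons y C = blockCons (x * y) (B * C) := by
  ext i k
  refine Fin.cases ?_ (fun i => ?_) i <;> refine Fin.cases ?_ (fun k => ?_) k <;>
    simp [Matrix.mul_apply, Fin.sum_univ_succ]

theorem blockCons_one : blockCons 1 (1 : Matrix (Fin m) (Fin m) ℝ) = 1 := by
  ext i k
  refine Fin.cases ?_ (fun i => ?_) i <;> refine Fin.cases ?_ (fun k => ?_) k <;>
    simp [Matrix.one_apply, Fin.succ_ne_zero, (Fin.succ_ne_zero _).symm]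

theorem blockCons_pow (j : ℕ) : blockCons x B ^ j = blockCons (x ^ j) (B ^ j) := by
  induction j with
  | zero => simp [blockCons_one]
  | succ j ih => rw [pow_succ, ih, blockCons_mul, pow_succ, pow_succ]

theorem smul_blockCons (t : ℝ) : t • blockCons x B = blockCons (t * x) (t • B) := by
  ext i k
  refine Fin.cases ?_ (fun i => ?_) i <;> refine Fin.cases ?_ (fun k => ?_) k <;> simp

theorem HasSum.blockCons {u : ℕ → ℝ} {V : ℕ → Matrix (Fin m) (Fin m) ℝ} {x : ℝ}
    {B : Matrix (Fin m) (Fin m) ℝ} (hu : HasSum u x) (hV : HasSum V B) :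
    HasSum (fun j => blockCons (u j) (V j)) (blockCons x B) := by
  refine Pi.hasSum.2 fun i => Pi.hasSum.2 fun k => ?_
  refine Fin.cases ?_ (fun i => ?_) i <;> refine Fin.cases ?_ (fun k => ?_) k
  · simpa using hu
  · simp
  · simp
  · simpa using Pi.hasSum.1 (Pi.hasSum.1 hV i) k

theorem approxError_blockCons_zero (p q : Fin (m + 1) → ℤ) :
    approxError (blockCons x B) p q 0 = x * q 0 - p 0 := by
  simp [approxError, Matrix.mulVec, dotProduct, Fin.sum_univ_succ]

theorem approxError_blockCons_succ (p q : Fin (m + 1) → ℤ) (i : Fin m) :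
    approxError (blockCons x B) p q i.succ =
      B.mulVec (fun k => (q k.succ : ℝ)) i - p i.succ := by
  simp [approxError, Matrix.mulVec, dotProduct, Fin.sum_univ_succ]

end blockCons

/-- A block diagonal matrix is a Liouville matrix if its first block is a Liouville number and its
second block maps no nonzero integer vector to an integer vector. -/
theorem isLiouvilleMatrix_blockCons {m : ℕ} {x : ℝ} {B : Matrix (Fin m) (Fin m) ℝ}
    (hx : Liouville x)
    (hB : ∀ q : Fin m → ℤ, q ≠ 0 → ∀ p : Fin m → ℤ,
      B.mulVec (fun k => (q k : ℝ)) ≠ fun k => (p k : ℝ)) :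
    IsLiouvilleMatrix (blockCons x B) := by
  refine ⟨fun p q hpq h0 => ?_, fun N => ?_⟩
  · have hq0 : q 0 = 0 := by
      by_contra hne
      have h := congrFun h0 0
      rw [approxError_blockCons_zero] at h
      have hne' : (q 0 : ℝ) ≠ 0 := Int.cast_ne_zero.2 hne
      refine hx.irrational ⟨(p 0 : ℚ) / q 0, ?_⟩
      push_cast
      rw [div_eq_iff hne']
      simp only [Pi.zero_apply] at h
      linarith
    have hqs : (fun k : Fin m => q k.succ) = 0 := by
      by_contra hne
      refine hB _ hne (fun k => p k.succ) (funext fun i => ?_)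
      have h := congrFun h0 i.succ
      rw [approxError_blockCons_succ] at h
      simpa [sub_eq_zero] using h
    have hq : q = 0 := by
      funext i
      exact Fin.cases hq0 (fun k => congrFun hqs k) i
    subst hq
    refine hpq (Prod.ext (funext fun i => ?_) rfl)
    have h := congrFun h0 i
    have hz : (fun j => (((0 : Fin (m + 1) → ℤ) j : ℤ) : ℝ)) = 0 := by
      funext j
      simp
    rw [approxError, hz, Matrix.mulVec_zero] at h
    simpa using h
  · intro hfin
    obtain ⟨M, hM⟩ := (hfin.image fun pq => (pq.2 0).toNat).bddAbove
    -- The exponent `N + 1` pays for the factor `b` in `x * b - a = b * (x - a / b)`. Taking `b > M`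
    -- yields a solution outside the supposedly finite set.
    obtain ⟨b, ⟨a, -, hab⟩, hbM⟩ := ((hx.frequently_exists_num (N + 1)).and_eventually
      (Filter.eventually_gt_atTop M)).exists
    have hb : (0 : ℝ) < b := by exact_mod_cast (Nat.zero_le M).trans_lt hbM
    set q : Fin (m + 1) → ℤ := Fin.cons (b : ℤ) 0
    set p : Fin (m + 1) → ℤ := Fin.cons a 0
    have hqn : ‖q‖ = b := by
      refine le_antisymm ((pi_norm_le_iff_of_nonneg hb.le).2 fun i => ?_) ?_
      · refine Fin.cases ?_ (fun i => ?_) i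
        · simp [q]
        · simp [q]
      · simpa [q] using norm_le_pi_norm q 0
    have hmem : (p, q) ∈ {pq : (Fin (m + 1) → ℤ) × (Fin (m + 1) → ℤ) | pq.2 ≠ 0 ∧
        ‖approxError (blockCons x B) pq.1 pq.2‖ < ‖pq.2‖ ^ (-(N : ℤ))} := by
      refine ⟨fun h => ?_, ?_⟩
      · have := congrArg norm h
        rw [hqn, norm_zero] at this
        exact hb.ne' this
      · have hpos : (0 : ℝ) < (b : ℝ) ^ (-(N : ℤ)) := zpow_pos hb _
        change ‖approxError (blockCons x B) p q‖ < ‖q‖ ^ (-(N : ℤ))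
        rw [hqn, pi_norm_lt_iff hpos]
        refine Fin.cases ?_ fun i => ?_
        · have h1 : x * b - a = b * (x - a / b) := by
            field_simp
          rw [approxError_blockCons_zero]
          simp only [q, p, Fin.cons_zero, Int.cast_natCast]
          rw [h1, Real.norm_eq_abs, abs_mul, abs_of_pos hb, zpow_neg, zpow_natCast]
          calc (b : ℝ) * |x - a / b| < b * (1 / (b : ℝ) ^ (N + 1)) :=
                mul_lt_mul_of_pos_left hab hb
            _ = ((b : ℝ) ^ N)⁻¹ := by
                field_simp
                ring
        · rw [approxError_blockCons_succ]
          have h0 : (fun k : Fin m => ((q k.succ : ℤ) : ℝ)) = 0 := by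
            funext k
            simp [q]
          rw [h0]
          simpa [p] using hpos
    have := hM ⟨(p, q), hmem, rfl⟩
    simp only [q, Fin.cons_zero, Int.toNat_natCast] at this
    omega

/-! ### Hausdorff dimension -/

/-- A set of positive Lebesgue measure in `ℝ ^ ι` has Hausdorff dimension `#ι`. -/
theorem dimH_eq_card_of_volume_ne_zero {ι : Type*} [Fintype ι] {S : Set (ι → ℝ)}
    (hS : MeasureTheory.volume S ≠ 0) : dimH S = Fintype.card ι := by
  refine le_antisymm ((dimH_mono (Set.subset_univ S)).trans_eq (Real.dimH_univ_pi ι)) ?_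
  have := le_dimH_of_hausdorffMeasure_ne_zero (d := (Fintype.card ι : NNReal)) (s := S)
    (by simpa [MeasureTheory.hausdorffMeasure_pi_real] using hS)
  simpa using this

section HausdorffDimension

attribute [local instance] Matrix.normedAddCommGroup

/-- Both sides carry the supremum metric, and the entries outside the block `B` do not depend on
`b`. -/
theorem isometry_blockCons_matrixOfPairs {m : ℕ} (x : ℝ) :
    Isometry fun b : Fin m × Fin m → ℝ => blockCons x (matrixOfPairs b) := by
  refine Isometry.of_dist_eq fun b b' => le_antisymm ?_ ?_
  · refine (dist_pi_le_iff dist_nonneg).2 fun i => (dist_pi_le_iff dist_nonneg).2 fun k => ?_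
    refine Fin.cases ?_ (fun i => ?_) i <;> refine Fin.cases ?_ (fun k => ?_) k
    · simp
    · simp
    · simp
    · exact dist_le_pi_dist b b' (i, k)
  · refine (dist_pi_le_iff dist_nonneg).2 fun ⟨i, k⟩ => ?_
    have h1 := dist_le_pi_dist (blockCons x (matrixOfPairs b)) (blockCons x (matrixOfPairs b'))
      i.succ
    have h2 := dist_le_pi_dist (blockCons x (matrixOfPairs b) i.succ)
      (blockCons x (matrixOfPairs b') i.succ) k.succ
    exact h2.trans h1

theorem matrixDimH_image_blockCons {m : ℕ} (x : ℝ) {S : Set (Fin m × Fin m → ℝ)}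
    (hS : MeasureTheory.volume S ≠ 0) :
    matrixDimH ((fun b => blockCons x (matrixOfPairs b)) '' S) = ((m ^ 2 : ℕ) : ℝ≥0∞) := by
  rw [matrixDimH, (isometry_blockCons_matrixOfPairs x).dimH_image,
    dimH_eq_card_of_volume_ne_zero hS]
  simp [sq]

theorem matrixDimH_mono {m n : ℕ} {S T : Set (Matrix (Fin m) (Fin n) ℝ)} (h : S ⊆ T) :
    matrixDimH S ≤ matrixDimH T :=
  dimH_mono h

theorem matrixDimH_empty {m n : ℕ} : matrixDimH (∅ : Set (Matrix (Fin m) (Fin n) ℝ)) = 0 :=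
  dimH_empty

end HausdorffDimension

/-! ### Assembly -/

/-- For countably many nonconstant power series converging on `(-r, r)` there is a set of
`(m + 1) × (m + 1)` matrices of Hausdorff dimension `m ^ 2` on which all of them take values in the
Liouville matrices. -/
theorem exists_matrixDimH_eq_and_forall_tsum_liouville (m : ℕ) {c : ℕ → ℕ → ℝ} {r : ℝ}
    (hr : 0 < r) (hc : ∀ k (x : ℝ), |x| < r → Summable fun j => c k j * x ^ j)
    (hne : ∀ k, ∃ j, 1 ≤ j ∧ c k j ≠ 0) :
    ∃ Ω : Set (Matrix (Fin (m + 1)) (Fin (m + 1)) ℝ),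
      matrixDimH Ω = ((m ^ 2 : ℕ) : ℝ≥0∞) ∧
      ∀ A ∈ Ω, ∀ k, (Summable fun j => c k j • A ^ j) ∧
        IsLiouvilleMatrix (∑' j, c k j • A ^ j) := by
  obtain ⟨x, hxr, hxL⟩ := exists_forall_liouville_tsum hr hc hne
  set U : Set (Fin m × Fin m → ℝ) := {b | ∑ p, |b p| < r / 2 ∧ (matrixOfPairs b).det ≠ 0}
  -- The index set is countable, so the union of these null sets is null.
  set E : ℕ × {q : Fin m → ℤ // q ≠ 0} × (Fin m → ℤ) → Set (Fin m × Fin m → ℝ) := fun a =>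
    {b | (∑ p, |b p| < r / 2 ∧ (matrixOfPairs b).det ≠ 0) ∧
      (∑' j, c a.1 j • matrixOfPairs b ^ j).mulVec (fun i => (a.2.1.1 i : ℝ)) =
        fun i => (a.2.2 i : ℝ)}
  have hE : MeasureTheory.volume (⋃ a, E a) = 0 := by
    refine MeasureTheory.measure_iUnion_null fun a => ?_
    refine volume_setOf_mulVec_tsum_eq (hc a.1) (hne a.1) (fun h => a.2.1.2 ?_) _
    funext i
    simpa using congrFun h i
  have hS : MeasureTheory.volume (U \ ⋃ a, E a) ≠ 0 := by
    rw [MeasureTheory.measure_sdiff_null hE]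
    exact ((isOpen_setOf_sum_abs_lt_and_det_ne_zero m (r / 2)).measure_pos _
      (nonempty_setOf_sum_abs_lt_and_det_ne_zero m (half_pos hr))).ne'
  refine ⟨_, matrixDimH_image_blockCons x hS, ?_⟩
  rintro _ ⟨b, ⟨hbU, hbE⟩, rfl⟩ k
  have hbr : ∑ p, |b p| < r := hbU.1.trans (half_lt_self hr)
  have hsum : HasSum (fun j => c k j • blockCons x (matrixOfPairs b) ^ j)
      (blockCons (∑' j, c k j * x ^ j) (∑' j, c k j • matrixOfPairs b ^ j)) := by
    simp only [blockCons_pow, smul_blockCons]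
    exact (hc k x hxr).hasSum.blockCons (summable_smul_matrixOfPairs_pow (hc k) hbr).hasSum
  refine ⟨hsum.summable, ?_⟩
  rw [hsum.tsum_eq]
  refine isLiouvilleMatrix_blockCons (hxL k) fun q hq p h => hbE ?_
  exact Set.mem_iUnion.2 ⟨(k, ⟨q, hq⟩, p), hbU, h⟩

theorem theoremt2 (n : ℕ) (hn : 2 ≤ n)
    (I : Set ℝ) (hI_open : IsOpen I) (hI_interval : I.OrdConnected) (hI_zero : (0 : ℝ) ∈ I)
    (f : ℕ → ℝ → ℝ)
    (hf_analytic : ∀ k, AnalyticOnNhd ℝ (f k) I)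
    (hf_nonconst : ∀ k, ¬ ∃ c : ℝ, ∀ x ∈ I, f k x = c)
    (r : ℝ) (hr : 0 < r)
    (hf_conv : ∀ k, ∀ x : ℝ, |x| < r → Summable fun j : ℕ => taylorCoeffZero (f k) j * x ^ j) :
    (∃ Ω : Set (Matrix (Fin n) (Fin n) ℝ),
      Ω ⊆ liouvilleMatrices n n ∧
      matrixDimH Ω = (((n - 1) ^ 2 : ℕ) : ℝ≥0∞) ∧
      ∀ A ∈ Ω, ∀ k, A ∈ matrixExtDomain n (f k) ∧
        matrixExt n (f k) A ∈ liouvilleMatrices n n) ∧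
    (((n - 1) ^ 2 : ℕ) : ℝ≥0∞) ≤
      matrixDimH ({A | ∀ k, A ∈ matrixExtDomain n (f k) ∧
        matrixExt n (f k) A ∈ liouvilleMatrices n n} ∩ liouvilleMatrices n n) ∧
    ({A | ∀ k, A ∈ matrixExtDomain n (f k) ∧
        matrixExt n (f k) A ∈ liouvilleMatrices n n} ∩ liouvilleMatrices n n).Nonempty := by
  obtain ⟨m, rfl⟩ : ∃ m, n = m + 1 := ⟨n - 1, by omega⟩
  obtain ⟨Ω, hdim, hΩ⟩ := exists_matrixDimH_eq_and_forall_tsum_liouville m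
    -- The series `z` is put in front of the given ones, so that each `A ∈ Ω` is itself a Liouville
    -- matrix.
    (c := fun k => Nat.casesOn k (Pi.single 1 1) fun k => taylorCoeffZero (f k)) hr
    (fun k x hx => by
      cases k with
      | zero =>
        refine summable_of_ne_finset_zero (s := {1}) fun j hj => ?_
        rw [Finset.mem_singleton] at hj
        simp [hj]
      | succ k => exact hf_conv k x hx)
    (fun k => by
      cases k with
      | zero => exact ⟨1, le_rfl, by simp⟩
      | succ k =>
        exact exists_taylorCoeffZero_ne_zero hI_interval hI_zero (hf_analytic k) (hf_nonconst k))
  have hL : Ω ⊆ liouvilleMatrices (m + 1) (m + 1) := fun A hA => by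
    have h : IsLiouvilleMatrix (∑' j, (Pi.single 1 1 : ℕ → ℝ) j • A ^ j) := (hΩ A hA 0).2
    have hs : ∑' j, (Pi.single 1 1 : ℕ → ℝ) j • A ^ j = A := by
      rw [tsum_eq_single 1 fun j hj => by simp [hj]]
      simp
    rwa [hs] at h
  have hf : ∀ A ∈ Ω, ∀ k, A ∈ matrixExtDomain (m + 1) (f k) ∧
      matrixExt (m + 1) (f k) A ∈ liouvilleMatrices (m + 1) (m + 1) :=
    fun A hA k => hΩ A hA (k + 1)
  have hsub : Ω ⊆ {A | ∀ k, A ∈ matrixExtDomain (m + 1) (f k) ∧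
      matrixExt (m + 1) (f k) A ∈ liouvilleMatrices (m + 1) (m + 1)} ∩
      liouvilleMatrices (m + 1) (m + 1) := fun A hA => ⟨hf A hA, hL hA⟩
  rw [Nat.add_sub_cancel]
  refine ⟨⟨Ω, hL, hdim, hf⟩, hdim ▸ matrixDimH_mono hsub, Set.Nonempty.mono hsub ?_⟩
  -- The empty set has dimension `0`, whereas `m ≥ 1` makes `m ^ 2` positive.
  rw [Set.nonempty_iff_ne_empty]
  rintro rfl
  rw [matrixDimH_empty] at hdim
  have : m ^ 2 = 0 := by exact_mod_cast hdim.symm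
  have := pow_eq_zero_iff (two_ne_zero) |>.1 this
  omega
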